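/- Let $\mathcal A$ be a bicomplete abelian category (with hom-sets) in which the subobjects of every object form a set. A preradical of $\mathcal A$ is a subobject $\tau\colon T\hookrightarrow 1_{\mathcal A}$ of the identity functor in $\mathrm{Fun}(\mathcal A,\mathcal A)$; preradicals are ordered as subobjects, and joins are least upper bounds for this order (of collections which need not be sets). The product of $\tau\colon T\hookrightarrow 1_{\mathcal A}$ and $\sigma\colon S\hookrightarrow 1_{\mathcal A}$ is the preradical $\tau\cdot\sigma$ represented by $\sigma\circ\tau S\colon TS\to 1_{\mathcal A}$, and $\tau$ is idempotent if $\tau\cdot\tau=\tau$. For a morphism $h\colon N\to M$ of $\mathcal A$, let $\mathbb A_M^N$ be the functor $L\mapsto N^{(\mathrm{Hom}_{\mathcal A}(M,L))}$ (the coproduct of copies of $N$ indexed by $\mathrm{Hom}_{\mathcal A}(M,L)$), with $\mathbb A_M^N(\lambda)\circ i_f=i_{\lambda\circ f}$ for $\lambda\colon L\to L'$ and $f\colon M\to L$, where $i_f$ denotes the canonical inclusion of the copy of $N$ indexed by $f$. Let $\mathfrak a_h\colon\mathbb A_M^N\to 1_{\mathcal A}$ be the natural transformation with $[\mathfrak a_h]_L\circ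 i_f=f\circ h$ for all $f\colon M\to L$, and let the alpha preradical $\alpha_h:=\mathrm{Im}(\mathfrak a_h)$ be its image. Proposition 7.10. Let $\tau\colon T\hookrightarrow 1_{\mathcal A}$ be a preradical of $\mathcal A$, and let $\mathbb T_\tau$ be the class of all objects $M$ of $\mathcal A$ such that $\tau_M\colon T(M)\to M$ is an isomorphism. Then $\tau$ is idempotent if and only if $$\tau=\bigvee_{M\in\mathbb T_\tau}\alpha_{1_M}.$$ -/

import Mathlib

open CategoryTheory CategoryTheory.Limits Opposite

universe v u

noncomputable section

namespace PreradicalCat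

/-- A preradical of an abelian category `C`: a subobject (that is, an equivalence class of
monomorphisms) of the identity functor in the functor category `C ⥤ C`, with the usual
partial order of subobjects. -/
abbrev Pr (C : Type u) [Category.{v} C] [Abelian C] : Type (max u v) :=
  Subobject (𝟭 C)

section Product

variable {C : Type u} [Category.{v} C] [Abelian C]

/-- The endofunctor `T` of a representative `T ⟶ 𝟭 C` of the preradical `τ`. -/
abbrev Pr.functor (τ : Pr C) : C ⥤ C := Subobject.underlying.obj τ

/-- A representative monomorphism `T ⟶ 𝟭 C` of the preradical `τ`. -/
abbrev Pr.ι (τ : Pr C) : τ.functor ⟶ 𝟭 C := Subobject.arrow τ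

instance Pr.mono_whiskerLeft_comp (τ σ : Pr C) :
    Mono ((Functor.whiskerLeft σ.functor τ.ι ≫ σ.ι : σ.functor ⋙ τ.functor ⟶ 𝟭 C)) := by
  have h : Mono (Functor.whiskerLeft σ.functor τ.ι) := by
    rw [NatTrans.mono_iff_mono_app]
    intro X
    exact inferInstanceAs (Mono (τ.ι.app (σ.functor.obj X)))
  exact mono_comp _ _

/-- The product `τ · σ` of two preradicals `τ : T ⟶ 𝟭 C` and `σ : S ⟶ 𝟭 C`: the subobject
represented by the composite `T ∘ S ⟶ S ⟶ 𝟭 C` with components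
`T (S X) ⟶ S X ⟶ X`, the first map being `τ` at `S X` and the second one `σ` at `X`. -/
def Pr.prod (τ σ : Pr C) : Pr C :=
  Subobject.mk (Functor.whiskerLeft σ.functor τ.ι ≫ σ.ι : σ.functor ⋙ τ.functor ⟶ 𝟭 C)

/-- A preradical is idempotent if `τ · τ = τ`. -/
def Pr.Idempotent (τ : Pr C) : Prop := τ.prod τ = τ

/-- The class of objects `M` such that `T M ⟶ M` is an isomorphism. -/
def Pr.torsionClass (τ : Pr C) : Set C := {M | IsIso (τ.ι.app M)}

end Product

section Alpha

variable {C : Type u} [Category.{v} C] [Abelian C] [HasColimits C]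

/-- The functor sending `L` to the coproduct of copies of `N` indexed by `M ⟶ L`; a morphism
`l : L ⟶ L'` sends the copy with index `f` identically to the copy with index `f ≫ l`. -/
def alphaFunctor (N M : C) : C ⥤ C :=
  coyoneda.obj (op M) ⋙ sigmaConst.{v}.obj N

/-- The natural transformation from `alphaFunctor N M` to the identity functor attached to
`h : N ⟶ M`; its component at `L` restricts to `h ≫ f` on the copy of `N` with index
`f : M ⟶ L`. -/
def alphaHom {N M : C} (h : N ⟶ M) : alphaFunctor N M ⟶ 𝟭 C where
  app L := Sigma.desc (fun f : M ⟶ L => h ≫ f)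
  naturality L L' l := by
    refine Sigma.hom_ext _ _ fun f => ?_
    simp [alphaFunctor, sigmaConst]

/-- The alpha preradical attached to `h : N ⟶ M`: the image of `alphaHom h` in `C ⥤ C`. -/
def alpha {N M : C} (h : N ⟶ M) : Pr C := imageSubobject (alphaHom h)

end Alpha

end PreradicalCat

end

namespace PreradicalCat

variable {C : Type u} [Category.{v} C]

section AlphaFunctor

variable [HasColimits C]

/-! By naturality of `τ`, a morphism from a torsion object `M` to `L` factors through `T L`, and
then, applying this again, through `T (T L)`. Hence every `alpha (𝟙 M)` lies below `τ · τ ≤ τ`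
(`alpha_id_le_prod_self`), and if `τ` is the join then `τ ≤ τ · τ`. Conversely, for idempotent `τ`
each `T X` is itself torsion, so any upper bound `σ` must factor `T X ⟶ X`, which gives `τ ≤ σ`. -/

/-- The inclusion of the copy of `N` with index `f : M ⟶ L`. -/
noncomputable def alphaFunctorι (N : C) {M L : C} (f : M ⟶ L) : N ⟶ (alphaFunctor N M).obj L :=
  Sigma.ι (fun _ : M ⟶ L => N) f

/-- The morphism out of `alphaFunctor N M` at `L` with given restrictions. -/
noncomputable def alphaFunctorDesc {N M L X : C} (k : (M ⟶ L) → (N ⟶ X)) : (alphaFunctor N M).obj L ⟶ X :=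
  Sigma.desc k

lemma alphaFunctor_hom_ext {N M L X : C} {g g' : (alphaFunctor N M).obj L ⟶ X}
    (hg : ∀ f : M ⟶ L, alphaFunctorι N f ≫ g = alphaFunctorι N f ≫ g') : g = g' :=
  Sigma.hom_ext _ _ hg

lemma alphaFunctorι_desc {N M L X : C} (k : (M ⟶ L) → (N ⟶ X)) (f : M ⟶ L) :
    alphaFunctorι N f ≫ alphaFunctorDesc k = k f :=
  Sigma.ι_desc _ _

lemma alphaFunctorι_alphaHom_app {N M L : C} (h : N ⟶ M) (f : M ⟶ L) :
    alphaFunctorι N f ≫ (alphaHom h).app L = h ≫ f :=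
  Sigma.ι_desc _ _

end AlphaFunctor

variable [Abelian C]

/-- A natural transformation which factors componentwise through a monomorphism of functors
factors through it. -/
lemma exists_lift_of_app {D : Type*} [Category D] {F G H : D ⥤ C} (g : F ⟶ G) (m : H ⟶ G)
    [Mono m] (hg : ∀ X, ∃ k : F.obj X ⟶ H.obj X, k ≫ m.app X = g.app X) :
    ∃ k : F ⟶ H, k ≫ m = g := by
  choose k hk using hg
  refine ⟨{ app := k, naturality := fun X Y f => ?_ }, ?_⟩
  -- Naturality of the chosen lifts is automatic: it can be checked after the mono `m.app Y`.
  · rw [← cancel_mono (m.app Y), Category.assoc, Category.assoc, hk, m.naturality,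
      reassoc_of% (hk X), g.naturality]
  · ext X
    exact hk X

/-- The order of preradicals is tested on components. -/
lemma Pr.le_of_app {τ σ : Pr C}
    (h : ∀ X, ∃ k : τ.functor.obj X ⟶ σ.functor.obj X, k ≫ σ.ι.app X = τ.ι.app X) :
    τ ≤ σ := by
  obtain ⟨k, hk⟩ := exists_lift_of_app τ.ι σ.ι h
  exact Subobject.le_of_comm k hk

lemma Pr.prod_le (τ σ : Pr C) : τ.prod σ ≤ σ :=
  Subobject.mk_le_of_comm (Functor.whiskerLeft σ.functor τ.ι) rfl

/-- If `τ` is idempotent, then every `T X` is torsion. -/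
lemma Pr.Idempotent.functor_obj_mem_torsionClass {τ : Pr C} (hτ : τ.Idempotent) (X : C) :
    τ.functor.obj X ∈ τ.torsionClass := by
  have hle : τ ≤ τ.prod τ := hτ.ge
  have hk := Subobject.ofLEMk_comp (f := Functor.whiskerLeft τ.functor τ.ι ≫ τ.ι) hle
  set k := Subobject.ofLEMk τ (Functor.whiskerLeft τ.functor τ.ι ≫ τ.ι) hle
  -- Cancelling the mono `T X ⟶ X` turns `τ ≤ τ · τ` into a section of `T (T X) ⟶ T X`.
  have h1 : k.app X ≫ τ.ι.app (τ.functor.obj X) = 𝟙 _ := by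
    rw [← cancel_mono (τ.ι.app X)]
    simpa using NatTrans.congr_app hk X
  have : IsSplitEpi (τ.ι.app (τ.functor.obj X)) := ⟨⟨⟨k.app X, h1⟩⟩⟩
  exact isIso_of_mono_of_isSplitEpi _

/-- A morphism `f : M ⟶ L` from a torsion object factors through `T L`. -/
lemma Pr.exists_factor_of_mem_torsionClass {τ : Pr C} {M : C} (hM : M ∈ τ.torsionClass)
    {L : C} (f : M ⟶ L) : ∃ k : M ⟶ τ.functor.obj L, k ≫ τ.ι.app L = f := by
  have : IsIso (τ.ι.app M) := hM
  refine ⟨inv (τ.ι.app M) ≫ τ.functor.map f, ?_⟩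
  rw [Category.assoc, τ.ι.naturality, IsIso.inv_hom_id_assoc]
  rfl

section Alpha

variable [HasColimits C]

/-- `alpha h` is contained in the subobject represented by `m : S ⟶ 𝟭 C` as soon as all the
morphisms `h ≫ f` factor through the components of `m`. -/
lemma alpha_le_mk {N M : C} (h : N ⟶ M) {S : C ⥤ C} (m : S ⟶ 𝟭 C) [Mono m]
    (hm : ∀ (L : C) (f : M ⟶ L), ∃ k : N ⟶ S.obj L, k ≫ m.app L = h ≫ f) :
    alpha h ≤ Subobject.mk m := by
  obtain ⟨k, hk⟩ := exists_lift_of_app (alphaHom h) m fun L => by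
    choose k hk using hm L
    refine ⟨alphaFunctorDesc k, alphaFunctor_hom_ext fun f => ?_⟩
    rw [alphaFunctorι_alphaHom_app, ← Category.assoc, alphaFunctorι_desc, hk]
  refine imageSubobject_le (alphaHom h) (k ≫ (Subobject.underlyingIso m).inv) ?_
  rw [Category.assoc, Subobject.underlyingIso_arrow, hk]

/-- If `alpha h ≤ σ`, then all the morphisms `h ≫ f` factor through the components of `σ`. -/
lemma exists_factor_of_alpha_le {N M : C} {h : N ⟶ M} {σ : Pr C} (hσ : alpha h ≤ σ)
    {L : C} (f : M ⟶ L) : ∃ k : N ⟶ σ.functor.obj L, k ≫ σ.ι.app L = h ≫ f := by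
  have hσ' : imageSubobject (alphaHom h) ≤ σ := hσ
  obtain ⟨k, hk⟩ : ∃ k : alphaFunctor N M ⟶ σ.functor, k ≫ σ.ι = alphaHom h :=
    ⟨factorThruImageSubobject (alphaHom h) ≫ Subobject.ofLE _ σ hσ', by
      rw [Category.assoc, Subobject.ofLE_arrow, imageSubobject_arrow_comp]⟩
  refine ⟨alphaFunctorι N f ≫ k.app L, ?_⟩
  rw [Category.assoc, ← NatTrans.comp_app, hk, alphaFunctorι_alphaHom_app]

/-- The alpha preradicals of torsion objects of `τ` are contained in `τ · τ`. -/
lemma alpha_id_le_prod_self {τ : Pr C} {M : C} (hM : M ∈ τ.torsionClass) :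
    alpha (𝟙 M) ≤ τ.prod τ := by
  refine alpha_le_mk _ _ fun L f => ?_
  obtain ⟨k, hk⟩ := Pr.exists_factor_of_mem_torsionClass hM f
  obtain ⟨l, hl⟩ := Pr.exists_factor_of_mem_torsionClass hM k
  refine ⟨l, ?_⟩
  rw [NatTrans.comp_app, Functor.whiskerLeft_app, reassoc_of% hl, hk, Category.id_comp]

end Alpha

end PreradicalCat

open PreradicalCat in
theorem proposition7p10 {C : Type u} [Category.{v} C] [Abelian C]
    [HasLimits C] [HasColimits C] [WellPowered.{v} C] (τ : PreradicalCat.Pr C) :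
    τ.Idempotent ↔
      IsLUB {σ : PreradicalCat.Pr C | ∃ M ∈ τ.torsionClass, σ = PreradicalCat.alpha (𝟙 M)} τ := by
  refine ⟨fun hτ => ⟨?_, fun σ hσ => Pr.le_of_app fun X => ?_⟩, fun hτ => ?_⟩
  · rintro _ ⟨M, hM, rfl⟩
    exact (alpha_id_le_prod_self hM).trans (Pr.prod_le τ τ)
  -- The torsion object to test is `T X`, with `T X ⟶ X` as the morphism to factor through `σ`.
  · obtain ⟨k, hk⟩ := exists_factor_of_alpha_le
      (hσ ⟨_, hτ.functor_obj_mem_torsionClass X, rfl⟩) (τ.ι.app X)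
    exact ⟨k, hk.trans (Category.id_comp _)⟩
  · refine (Pr.prod_le τ τ).antisymm (hτ.2 ?_)
    rintro _ ⟨M, hM, rfl⟩
    exact alpha_id_le_prod_self hM
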